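/- Let $H$ be a (real or complex) Hilbert space, possibly infinite-dimensional and not necessarily separable, and let $k\ge 1$ be an integer. Let $\mathcal E^kH$ be the set of empirical measures of size $k$ on $H$, that is, of the Borel measures $\frac1k\sum_{i=1}^k\delta_{x_i}$ with $x_1,\dots,x_k\in H$, equipped with the $1$-Wasserstein distance $$W_1(\alpha,\beta)=\inf_{\gamma}\int_{H\times H}\|x-y\|\,d\gamma(x,y),$$ where $\gamma$ ranges over the Borel measures on $H\times H$ with marginals $\alpha$ and $\beta$. Then there are a real Hilbert space $H'$ and a coarse embedding $\phi:\mathcal E^kH\to H'$; that is, there are a map $\phi:\mathcal E^kH\to H'$ and non-decreasing functions $\rho_-,\rho_+:[0,\infty)\to[0,\infty)$ with $\lim_{t\to\infty}\rho_-(t)=\infty$ such that $$\rho_-(W_1(\alpha,\beta))\le\|\phi(\alpha)-\phi(\beta)\|\le\rho_+(W_1(\alpha,\beta))\qquad\text{for all }\alpha,\beta\in\mathcal E^kH.$$ -/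

import Mathlib

open MeasureTheory Filter
open scoped ENNReal

universe u

/-- `γ` is a Borel measure on `X × X` with marginals `α` and `β`.  The product carries its own
Borel σ-algebra, which contains the product σ-algebra and equals it when `X` is separable. -/
def IsCoupling {X : Type*} [MetricSpace X] [MeasurableSpace X]
    (α β : Measure X) (γ : @Measure (X × X) (borel (X × X))) : Prop :=
  @Measure.map (X × X) X (borel (X × X)) _ Prod.fst γ = α ∧
    @Measure.map (X × X) X (borel (X × X)) _ Prod.snd γ = β

/-- The `1`-Wasserstein distance: the infimum of `∫ d(x, y) dγ(x, y)` over all couplings `γ`. -/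
noncomputable def wassersteinOne {X : Type*} [MetricSpace X] [MeasurableSpace X]
    (α β : Measure X) : ℝ :=
  (⨅ (γ : @Measure (X × X) (borel (X × X))) (_ : IsCoupling α β γ),
    @lintegral (X × X) (borel (X × X)) γ (fun z => edist z.1 z.2)).toReal

/-- The measure `(1 / k) ∑ i, δ_{x i}`. -/
noncomputable def empiricalMeasure {X : Type*} [MeasurableSpace X] {k : ℕ} (x : Fin k → X) :
    Measure X :=
  (k : ℝ≥0∞)⁻¹ • ∑ i, Measure.dirac (x i)

/-- The set of empirical measures of size `k` on `X`. -/
def EmpiricalSpace (k : ℕ) (X : Type*) [MeasurableSpace X] : Type _ :=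
  {α : Measure X // ∃ x : Fin k → X, α = empiricalMeasure x}

/-- Empirical measures are compared by the `1`-Wasserstein distance. -/
noncomputable instance EmpiricalSpace.instDist (k : ℕ) (X : Type*) [MetricSpace X]
    [MeasurableSpace X] : Dist (EmpiricalSpace k X) :=
  ⟨fun α β => wassersteinOne α.1 β.1⟩

/-- `f` is a coarse embedding: there are non-decreasing control functions
`[0, ∞) → [0, ∞)`, the lower one tending to infinity.  They are written as functions on `ℝ` of which
only the restriction to `[0, ∞)` matters. -/
def IsCoarseEmbedding {X Y : Type*} [Dist X] [Dist Y] (f : X → Y) : Prop :=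
  ∃ ρ₁ ρ₂ : ℝ → ℝ,
    MonotoneOn ρ₁ (Set.Ici 0) ∧ MonotoneOn ρ₂ (Set.Ici 0) ∧
    (∀ t, 0 ≤ t → 0 ≤ ρ₁ t) ∧ (∀ t, 0 ≤ t → 0 ≤ ρ₂ t) ∧
    Tendsto ρ₁ atTop atTop ∧
    ∀ x x' : X, ρ₁ (dist x x') ≤ dist (f x) (f x') ∧ dist (f x) (f x') ≤ ρ₂ (dist x x')

/-! Send a configuration, at each scale `a ^ n` with `a = (4k)⁻²`, to the mean of the Gaussian
features of its rescaled points, and collect all scales in ℓ². Scale `n` is `a ^ n`-Lipschitz for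
`W₁` by Kantorovich duality (`norm_mean_sub_mean_le_wassersteinOne`), so the whole map is Lipschitz.
For the lower bound, call a scale good if no rescaled distance among the `2k` points of two
configurations lies strictly between `(4k)⁻¹` and `4k`. At a good scale the points form clusters on
which the Gaussian is nearly 0 or 1; either both configurations put equally many points in each
cluster, which makes `W₁` small, or the features differ by a fixed amount (`matching_or_far`). At
most `4k²` scales are bad (`card_bad_scales_le`), so the squared distance grows at least like `log
W₁`. -/

/-! ### Gaussian kernel and its feature map -/

section Feature

/-- Tensor powers: the kernel `⟪x, y⟫ ^ n` has a feature map. -/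
theorem exists_feature_inner_pow (E : Type u) [NormedAddCommGroup E] [InnerProductSpace ℝ E]
    (n : ℕ) :
    ∃ (F : Type u) (_ : NormedAddCommGroup F) (_ : InnerProductSpace ℝ F) (f : E → F),
      ∀ x y, inner ℝ (f x) (f y) = inner ℝ x y ^ n := by
  induction n with
  | zero =>
    refine ⟨EuclideanSpace ℝ PUnit.{u + 1}, inferInstance, inferInstance,
      fun _ => WithLp.toLp 2 fun _ => 1, fun x y => ?_⟩
    simp [EuclideanSpace.norm_eq]
  | succ n ih =>
    obtain ⟨F, _, _, f, hf⟩ := ih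
    refine ⟨TensorProduct ℝ F E, inferInstance, inferInstance,
      fun x => TensorProduct.tmul ℝ (f x) x, fun x y => ?_⟩
    rw [TensorProduct.inner_tmul, hf, pow_succ]

/-- The Gaussian kernel on a real inner product space has a feature map into a Hilbert space. -/
theorem exists_gaussian_feature (E : Type u) [NormedAddCommGroup E] [InnerProductSpace ℝ E] :
    ∃ (F : Type u) (_ : NormedAddCommGroup F) (_ : InnerProductSpace ℝ F) (_ : CompleteSpace F)
      (f : E → F), ∀ x y, inner ℝ (f x) (f y) = Real.exp (-(‖x - y‖ ^ 2 / 2)) := by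
  choose G i₁ i₂ g hg using exists_feature_inner_pow E
  have hexp (x y : E) : HasSum (fun n : ℕ => inner ℝ x y ^ n / (n.factorial : ℝ))
      (Real.exp (inner ℝ x y)) := by
    rw [Real.exp_eq_exp_ℝ]
    exact NormedSpace.expSeries_div_hasSum_exp _
  have key (x y : E) (n : ℕ) :
      inner ℝ ((√(n.factorial : ℝ))⁻¹ • g n x) ((√(n.factorial : ℝ))⁻¹ • g n y) =
        inner ℝ x y ^ n / (n.factorial : ℝ) := by
    rw [real_inner_smul_left, real_inner_smul_right, hg, ← mul_assoc, ← mul_inv,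
      Real.mul_self_sqrt (Nat.cast_nonneg _)]
    ring
  have hmem (x : E) : Memℓp (fun n : ℕ => (√(n.factorial : ℝ))⁻¹ • g n x) 2 := by
    refine memℓp_gen ?_
    refine (hexp x x).summable.congr fun n => ?_
    rw [← key, real_inner_self_eq_norm_sq]
    norm_num
  let h : E → lp G 2 := fun x => ⟨_, hmem x⟩
  have hh (x y : E) : inner ℝ (h x) (h y) = Real.exp (inner ℝ x y) := by
    rw [lp.inner_eq_tsum]
    simp only [h, key]
    exact (hexp x y).tsum_eq
  -- The tensor powers need not be complete. The scalar factor turns `exp ⟪x, y⟫` into the Gaussian.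
  refine ⟨UniformSpace.Completion (lp G 2), inferInstance, inferInstance, inferInstance,
    fun x => ((Real.exp (-(‖x‖ ^ 2 / 2)) • h x : lp G 2) : UniformSpace.Completion (lp G 2)),
    fun x y => ?_⟩
  rw [UniformSpace.Completion.inner_coe, real_inner_smul_left, real_inner_smul_right, hh,
    ← Real.exp_add, ← Real.exp_add, norm_sub_sq_real]
  congr 1
  ring

variable {E F : Type*} [NormedAddCommGroup E] [NormedAddCommGroup F] [InnerProductSpace ℝ F]

/-- With `r = ‖x - y‖`, the squared feature distance is `2 - 2 exp(-r²/2) ≤ r²`. -/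
theorem norm_sub_le_of_gaussian {f : E → F}
    (hf : ∀ x y, inner ℝ (f x) (f y) = Real.exp (-(‖x - y‖ ^ 2 / 2))) (x y : E) :
    ‖f x - f y‖ ≤ ‖x - y‖ := by
  have h (x : E) : ‖f x‖ ^ 2 = 1 := by rw [← real_inner_self_eq_norm_sq, hf]; simp
  refine le_of_sq_le_sq ?_ (norm_nonneg _)
  rw [norm_sub_sq_real, h, h, hf]
  linarith [Real.add_one_le_exp (-(‖x - y‖ ^ 2 / 2))]

end Feature

/-! ### Bounds on `W₁` from matchings and from Lipschitz functions -/

section Wasserstein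

theorem map_empiricalMeasure {Z X : Type*} [MeasurableSpace Z] [MeasurableSpace X] {k : ℕ}
    {g : Z → X} (hg : Measurable g) (z : Fin k → Z) :
    (empiricalMeasure z).map g = empiricalMeasure (g ∘ z) := by
  unfold empiricalMeasure
  rw [Measure.map_smul, ← Measure.mapₗ_apply_of_measurable hg, map_sum]
  simp [Measure.mapₗ_apply_of_measurable hg, Measure.map_dirac' hg]

theorem lintegral_empiricalMeasure {Z : Type*} [MeasurableSpace Z] {k : ℕ}
    {g : Z → ℝ≥0∞} (hg : Measurable g) (z : Fin k → Z) :
    ∫⁻ a, g a ∂(empiricalMeasure z) = (k : ℝ≥0∞)⁻¹ * ∑ i, g (z i) := by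
  unfold empiricalMeasure
  rw [lintegral_smul_measure, lintegral_finsetSum_measure]
  simp [lintegral_dirac' _ hg]

theorem integrable_empiricalMeasure {Z : Type*} [MeasurableSpace Z] {k : ℕ} (hk : 0 < k)
    {g : Z → ℝ} (hg : Measurable g) (z : Fin k → Z) : Integrable g (empiricalMeasure z) := by
  refine Integrable.smul_measure ?_ (by simp [hk.ne'])
  rw [integrable_finsetSum_measure]
  exact fun i _ => (integrable_dirac' hg.stronglyMeasurable (by simp))

theorem integral_empiricalMeasure {Z : Type*} [MeasurableSpace Z] {k : ℕ}
    {g : Z → ℝ} (hg : Measurable g) (z : Fin k → Z) :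
    ∫ a, g a ∂(empiricalMeasure z) = (k : ℝ)⁻¹ * ∑ i, g (z i) := by
  unfold empiricalMeasure
  rw [integral_smul_measure, integral_finsetSum_measure]
  · simp [integral_dirac' _ _ hg.stronglyMeasurable]
  · exact fun i _ => (integrable_dirac' hg.stronglyMeasurable (by simp))

variable {X : Type*} [MetricSpace X] [MeasurableSpace X] [BorelSpace X] {k : ℕ}

/-- The cost of a matching bounds the infimum over couplings. -/
theorem iInf_coupling_le_matching (x y : Fin k → X) (σ : Equiv.Perm (Fin k)) :
    (⨅ (γ : @Measure (X × X) (borel (X × X)))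
      (_ : IsCoupling (empiricalMeasure x) (empiricalMeasure y) γ),
      @lintegral (X × X) (borel (X × X)) γ (fun z => edist z.1 z.2)) ≤
      (k : ℝ≥0∞)⁻¹ * ∑ i, edist (x i) (y (σ i)) := by
  -- Without separability, the distance is sure to be measurable only for the Borel σ-algebra of the
  -- product.
  let _ : MeasurableSpace (X × X) := borel (X × X)
  have _ : BorelSpace (X × X) := ⟨rfl⟩
  have hy : empiricalMeasure (y ∘ σ) = empiricalMeasure y := by
    unfold empiricalMeasure
    congr 1
    exact Equiv.sum_comp σ fun i => Measure.dirac (y i)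
  have m₁ : Measurable (Prod.fst : X × X → X) := continuous_fst.measurable
  have m₂ : Measurable (Prod.snd : X × X → X) := continuous_snd.measurable
  have m₃ : Measurable (fun z : X × X => edist z.1 z.2) := continuous_edist.measurable
  have hγ : IsCoupling (empiricalMeasure x) (empiricalMeasure y)
      (empiricalMeasure fun i => (x i, y (σ i))) :=
    ⟨map_empiricalMeasure m₁ _, (map_empiricalMeasure m₂ _).trans hy⟩
  exact (iInf₂_le _ hγ).trans_eq (lintegral_empiricalMeasure m₃ _)

theorem wassersteinOne_le_matching (hk : 0 < k) (x y : Fin k → X) (σ : Equiv.Perm (Fin k)) {r : ℝ}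
    (h : ∀ i, dist (x i) (y (σ i)) ≤ r) :
    wassersteinOne (empiricalMeasure x) (empiricalMeasure y) ≤ r := by
  have hr : 0 ≤ r := dist_nonneg.trans (h ⟨0, hk⟩)
  refine ENNReal.toReal_le_of_le_ofReal hr ((iInf_coupling_le_matching x y σ).trans ?_)
  have h2 : ∑ i, edist (x i) (y (σ i)) ≤ ∑ _i : Fin k, ENNReal.ofReal r :=
    Finset.sum_le_sum fun i _ => by
      rw [edist_dist]
      exact ENNReal.ofReal_le_ofReal (h i)
  refine (mul_le_mul_right h2 _).trans_eq ?_
  rw [Finset.sum_const, Finset.card_univ, Fintype.card_fin, nsmul_eq_mul, ← mul_assoc,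
    ENNReal.inv_mul_cancel (by simp [hk.ne']) (by simp), one_mul]

/-- The easy half of Kantorovich duality. -/
theorem abs_mean_sub_mean_le_wassersteinOne (hk : 0 < k) {h : X → ℝ} (hh : LipschitzWith 1 h)
    (x y : Fin k → X) :
    |(k : ℝ)⁻¹ * ∑ i, h (x i) - (k : ℝ)⁻¹ * ∑ i, h (y i)| ≤
      wassersteinOne (empiricalMeasure x) (empiricalMeasure y) := by
  let _ : MeasurableSpace (X × X) := borel (X × X)
  have _ : BorelSpace (X × X) := ⟨rfl⟩
  rw [← Real.norm_eq_abs, ← toReal_enorm]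
  refine ENNReal.toReal_mono ?_ (le_iInf₂ fun γ hγ => ?_)
  -- Finiteness matters: `toReal` would send an infinite infimum to 0.
  · refine ne_top_of_le_ne_top ?_ (iInf_coupling_le_matching x y 1)
    exact ENNReal.mul_ne_top (by simp [hk.ne']) (by simp [edist_ne_top])
  · have hm : Measurable h := hh.continuous.measurable
    have m₁ : Measurable (Prod.fst : X × X → X) := continuous_fst.measurable
    have m₂ : Measurable (Prod.snd : X × X → X) := continuous_snd.measurable
    have e₁ : γ.map Prod.fst = empiricalMeasure x := hγ.1
    have e₂ : γ.map Prod.snd = empiricalMeasure y := hγ.2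
    have i₁ : Integrable (fun z : X × X => h z.1) γ := by
      have := integrable_empiricalMeasure hk hm x
      rw [← e₁] at this
      exact this.comp_measurable m₁
    have i₂ : Integrable (fun z : X × X => h z.2) γ := by
      have := integrable_empiricalMeasure hk hm y
      rw [← e₂] at this
      exact this.comp_measurable m₂
    rw [← integral_empiricalMeasure hm, ← integral_empiricalMeasure hm, ← e₁, ← e₂,
      integral_map m₁.aemeasurable hm.aestronglyMeasurable,
      integral_map m₂.aemeasurable hm.aestronglyMeasurable, ← integral_sub i₁ i₂]
    refine (enorm_integral_le_lintegral_enorm _).trans (lintegral_mono fun z => ?_)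
    simpa [edist_eq_enorm_sub] using hh z.1 z.2

/-- Pairing `f` with the direction of the difference of means reduces this to a scalar Lipschitz
test function. -/
theorem norm_mean_sub_mean_le_wassersteinOne (hk : 0 < k) {F : Type*} [NormedAddCommGroup F]
    [InnerProductSpace ℝ F] {f : X → F} {K : ℝ} (hK : 0 < K)
    (hf : ∀ x y, ‖f x - f y‖ ≤ K * dist x y) (x y : Fin k → X) :
    ‖(k : ℝ)⁻¹ • ∑ i, f (x i) - (k : ℝ)⁻¹ • ∑ i, f (y i)‖ ≤
      K * wassersteinOne (empiricalMeasure x) (empiricalMeasure y) := by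
  set v := (k : ℝ)⁻¹ • ∑ i, f (x i) - (k : ℝ)⁻¹ • ∑ i, f (y i) with hv
  rcases eq_or_ne v 0 with h0 | h0
  · rw [h0, norm_zero]
    exact mul_nonneg hK.le ENNReal.toReal_nonneg
  have hpos : 0 < ‖v‖ := norm_pos_iff.2 h0
  have hL : LipschitzWith 1 fun a => (K * ‖v‖)⁻¹ * inner ℝ v (f a) := by
    refine LipschitzWith.of_dist_le_mul fun a b => ?_
    rw [Real.dist_eq, ← mul_sub, ← inner_sub_right, abs_mul, abs_of_pos (by positivity),
      NNReal.coe_one, one_mul, inv_mul_le_iff₀ (by positivity)]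
    calc |inner ℝ v (f a - f b)| ≤ ‖v‖ * ‖f a - f b‖ := abs_real_inner_le_norm _ _
      _ ≤ ‖v‖ * (K * dist a b) := by gcongr; exact hf a b
      _ = K * ‖v‖ * dist a b := by ring
  have key := (le_abs_self _).trans (abs_mean_sub_mean_le_wassersteinOne hk hL x y)
  rw [← Finset.mul_sum, ← Finset.mul_sum, ← inner_sum, ← inner_sum, mul_left_comm,
    mul_left_comm (k : ℝ)⁻¹, ← mul_sub, ← real_inner_smul_right, ← real_inner_smul_right,
    ← inner_sub_right, ← hv, real_inner_self_eq_norm_sq, inv_mul_le_iff₀ (by positivity)] at key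
  nlinarith

end Wasserstein

/-! ### Clusters at a single good scale -/

section Matching

/-- Two families whose fibres have the same sizes differ by a permutation. -/
theorem exists_perm_of_card_fiber_eq {ι Q : Type*} [Fintype ι] [DecidableEq Q] (p q : ι → Q)
    (h : ∀ c, (Finset.univ.filter fun i => p i = c).card =
      (Finset.univ.filter fun i => q i = c).card) :
    ∃ σ : Equiv.Perm ι, ∀ i, q (σ i) = p i := by
  let e (c : Q) : {i // p i = c} ≃ {i // q i = c} := Fintype.equivOfCardEq (by
    rw [Fintype.card_subtype, Fintype.card_subtype, h])
  refine ⟨(Equiv.sigmaFiberEquiv p).symm.trans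
    ((Equiv.sigmaCongrRight e).trans (Equiv.sigmaFiberEquiv q)), fun i => ?_⟩
  exact (e (p i) ⟨i, rfl⟩).2

/-- The 0/1 kernel of a partition is the idealised Gaussian; its quadratic form is a sum of squared
cluster charges. -/
theorem sum_mul_ite_eq_sum_sq {ι Q : Type*} [Fintype ι] [Fintype Q] [DecidableEq Q]
    (p : ι → Q) (c : ι → ℝ) :
    ∑ a, ∑ b, c a * c b * (if p a = p b then 1 else 0) =
      ∑ s, (∑ a, if p a = s then c a else 0) ^ 2 := by
  simp_rw [sq, Finset.sum_mul_sum]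
  rw [Finset.sum_comm' (t' := Finset.univ) (s' := fun _ => Finset.univ) (by simp)]
  rw [Finset.sum_comm]
  symm
  rw [Finset.sum_comm]
  refine Finset.sum_congr rfl fun a _ => ?_
  rw [Finset.sum_comm]
  refine Finset.sum_congr rfl fun b _ => ?_
  simp only [ite_mul, zero_mul, mul_ite, mul_zero, mul_one]
  simp [eq_comm]

variable {E F : Type*} [NormedAddCommGroup E] [NormedAddCommGroup F] [InnerProductSpace ℝ F]
  {k : ℕ}

/-- If no distance among the points of two configurations lies in a wide window, then either the
configurations are matched by a permutation or their Gaussian features are far apart. -/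
theorem matching_or_far {f : E → F}
    (hf : ∀ x y, inner ℝ (f x) (f y) = Real.exp (-(‖x - y‖ ^ 2 / 2)))
    (hk : 0 < k) (x y : Fin k → E)
    (hgap : ∀ p q : Fin k ⊕ Fin k, dist (Sum.elim x y p) (Sum.elim x y q) ≤ (4 * k : ℝ)⁻¹ ∨
      (4 * k : ℝ) ≤ dist (Sum.elim x y p) (Sum.elim x y q)) :
    (∃ σ : Equiv.Perm (Fin k), ∀ i, dist (x i) (y (σ i)) ≤ (4 * k : ℝ)⁻¹) ∨
      1 / 2 ≤ ‖∑ i, f (x i) - ∑ i, f (y i)‖ ^ 2 := by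
  classical
  have hk1 : (1 : ℝ) ≤ k := by exact_mod_cast hk
  set z : Fin k ⊕ Fin k → E := Sum.elim x y with hz
  have hinv : (4 * k : ℝ)⁻¹ ≤ 4⁻¹ := by
    apply inv_anti₀ <;> linarith
  let S : Setoid (Fin k ⊕ Fin k) :=
    { r := fun p q => dist (z p) (z q) ≤ (4 * k : ℝ)⁻¹
      iseqv :=
        { refl := fun p => by rw [dist_self]; positivity
          symm := fun {p q} h => by rwa [dist_comm]
          -- Two short steps give at most `1/2 < 4k`, so the gap forces a short distance.
          trans := fun {p q r} h₁ h₂ => (hgap p r).resolve_right fun h => by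
            linarith [dist_triangle (z p) (z q) (z r)] } }
  have hS (p q) : (Quotient.mk S p = Quotient.mk S q) ↔ dist (z p) (z q) ≤ (4 * k : ℝ)⁻¹ :=
    Quotient.eq
  let c : Fin k ⊕ Fin k → ℝ := Sum.elim (fun _ => 1) fun _ => -1
  have hc (p) : |c p| = 1 := by rcases p with p | p <;> simp [c]
  -- Zero charge means equally many points of `x` and of `y` in the cluster.
  by_cases hbal : ∀ s : Quotient S, ∑ p, (if Quotient.mk S p = s then c p else 0) = 0
  · left
    obtain ⟨σ, hσ⟩ := exists_perm_of_card_fiber_eq (fun i : Fin k => Quotient.mk S (Sum.inl i))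
      (fun i : Fin k => Quotient.mk S (Sum.inr i)) fun s => by
        have := hbal s
        rw [Fintype.sum_sum_type] at this
        simp only [c, Sum.elim_inl, Sum.elim_inr, Finset.sum_ite, Finset.sum_const_zero, add_zero,
          Finset.sum_const, nsmul_eq_mul, mul_one, mul_neg] at this
        exact_mod_cast eq_of_sub_eq_zero ((sub_eq_add_neg _ _).trans this)
    exact ⟨σ, fun i => (hS (Sum.inl i) (Sum.inr (σ i))).1 (hσ i).symm⟩
  · right
    push Not at hbal
    obtain ⟨s, hs⟩ := hbal
    have hone : 1 ≤ ∑ a, ∑ b, c a * c b *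
        (if Quotient.mk S a = Quotient.mk S b then 1 else 0) := by
      rw [sum_mul_ite_eq_sum_sq]
      refine le_trans ?_ (Finset.single_le_sum (fun s _ => sq_nonneg _) (Finset.mem_univ s))
      -- Charges are integers, so a nonzero one has square at least 1.
      obtain ⟨m, hm⟩ : ∃ m : ℤ, (m : ℝ) = ∑ p, (if Quotient.mk S p = s then c p else 0) :=
        ⟨∑ p, (if Quotient.mk S p = s then Sum.elim (fun _ => 1) (fun _ => -1) p else 0), by
          push_cast
          refine Finset.sum_congr rfl fun p _ => ?_
          rcases p with p | p <;> simp [c]⟩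
      rw [← hm] at hs ⊢
      have : m ≠ 0 := by exact_mod_cast hs
      have : 0 < m ^ 2 := by positivity
      exact_mod_cast this
    have hv : ∑ i, f (x i) - ∑ i, f (y i) = ∑ p, c p • f (z p) := by
      rw [Fintype.sum_sum_type]
      simp [c, hz, sub_eq_add_neg]
    have hq : ‖∑ i, f (x i) - ∑ i, f (y i)‖ ^ 2 =
        ∑ a, ∑ b, c a * c b * Real.exp (-(‖z a - z b‖ ^ 2 / 2)) := by
      rw [hv, ← real_inner_self_eq_norm_sq, sum_inner]
      refine Finset.sum_congr rfl fun a _ => ?_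
      rw [inner_sum]
      refine Finset.sum_congr rfl fun b _ => ?_
      rw [real_inner_smul_left, real_inner_smul_right, hf, mul_assoc]
    -- Over the `(2k)²` pairs this error adds up to `1/2`, half of the lower bound `hone`.
    have hclose (a b) : |(if Quotient.mk S a = Quotient.mk S b then (1 : ℝ) else 0) -
        Real.exp (-(‖z a - z b‖ ^ 2 / 2))| ≤ (8 * k ^ 2 : ℝ)⁻¹ := by
      rw [← dist_eq_norm]
      have h2 : ((8 * k ^ 2 : ℝ))⁻¹ = 2 * (4 * k : ℝ)⁻¹ ^ 2 := by field_simp; norm_num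
      split_ifs with h
      · have h1 := (hS a b).1 h
        have h3 : dist (z a) (z b) ^ 2 ≤ (4 * k : ℝ)⁻¹ ^ 2 := by gcongr
        have h4 := Real.add_one_le_exp (-(dist (z a) (z b) ^ 2 / 2))
        have h5 : Real.exp (-(dist (z a) (z b) ^ 2 / 2)) ≤ 1 :=
          Real.exp_le_one_iff.2 (by simp; positivity)
        rw [abs_of_nonneg (by linarith)]
        nlinarith [sq_nonneg (dist (z a) (z b))]
      · have h1 : (4 * k : ℝ) ≤ dist (z a) (z b) := (hgap a b).resolve_left fun h' => h ((hS a b).2 h')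
        rw [zero_sub, abs_neg, abs_of_pos (Real.exp_pos _), Real.exp_neg]
        refine inv_anti₀ (by positivity) ?_
        have h3 : (4 * k : ℝ) ^ 2 ≤ dist (z a) (z b) ^ 2 := by gcongr
        linarith [Real.add_one_le_exp (dist (z a) (z b) ^ 2 / 2)]
    have hdiff : (∑ a, ∑ b, c a * c b *
        (if Quotient.mk S a = Quotient.mk S b then (1 : ℝ) else 0)) -
        ∑ a, ∑ b, c a * c b * Real.exp (-(‖z a - z b‖ ^ 2 / 2)) ≤ 1 / 2 := by
      calc _ = ∑ a, ∑ b, c a * c b * ((if Quotient.mk S a = Quotient.mk S b then (1 : ℝ) else 0) -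
            Real.exp (-(‖z a - z b‖ ^ 2 / 2))) := by
            simp only [← Finset.sum_sub_distrib, mul_sub]
        _ ≤ ∑ _a : Fin k ⊕ Fin k, ∑ _b : Fin k ⊕ Fin k, (8 * k ^ 2 : ℝ)⁻¹ := by
            refine Finset.sum_le_sum fun a _ => Finset.sum_le_sum fun b _ => ?_
            refine (le_abs_self _).trans ?_
            rw [abs_mul, abs_mul, hc, hc, one_mul, one_mul]
            exact hclose a b
        _ = 1 / 2 := by
            simp
            field_simp
            norm_num
    rw [hq]
    linarith

end Matching

/-! ### Counting bad scales -/

section Scales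

/-- At most `card ι ^ 2` scales see a distance in the window. -/
theorem card_bad_scales_le {ι : Type*} [Fintype ι] {M : ℝ} (hM : 1 ≤ M) (d : ι → ℝ)
    (L : ℕ) [DecidablePred fun n : ℕ => ∃ p, M⁻¹ < (M ^ 2)⁻¹ ^ n * d p ∧ (M ^ 2)⁻¹ ^ n * d p < M] :
    ((Finset.range L).filter fun n : ℕ =>
      ∃ p, M⁻¹ < (M ^ 2)⁻¹ ^ n * d p ∧ (M ^ 2)⁻¹ ^ n * d p < M).card ≤ Fintype.card ι := by
  classical
  -- The window has endpoint ratio `M ^ 2`, the ratio of consecutive scales, so each distance enters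
  -- it at most once.
  have key (n : ℕ) (p : ι) (h : M⁻¹ < (M ^ 2)⁻¹ ^ n * d p) (m : ℕ) (hm : m < n) :
      M ≤ (M ^ 2)⁻¹ ^ m * d p := by
    have hd : 0 < d p := by
      have : 0 < (M ^ 2)⁻¹ ^ n * d p := lt_trans (by positivity) h
      exact (pos_iff_pos_of_mul_pos this).1 (by positivity)
    have h1 : (M ^ 2)⁻¹ ^ n ≤ (M ^ 2)⁻¹ ^ (m + 1) :=
      pow_le_pow_of_le_one (by positivity) (inv_le_one_of_one_le₀ (one_le_pow₀ hM)) hm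
    have h2 : M⁻¹ < (M ^ 2)⁻¹ ^ (m + 1) * d p := h.trans_le (by gcongr)
    have h3 : M ^ 2 * M⁻¹ ≤ M ^ 2 * ((M ^ 2)⁻¹ ^ (m + 1) * d p) := by gcongr
    have hM0 : M ≠ 0 := by positivity
    calc M = M ^ 2 * M⁻¹ := by field_simp
      _ ≤ _ := h3
      _ = _ := by
        rw [pow_succ' _ m, mul_assoc, ← mul_assoc, mul_inv_cancel₀ (pow_ne_zero 2 hM0), one_mul]
  refine Finset.card_le_card_of_forall_subsingleton (t := Finset.univ)
    (fun n p => M⁻¹ < (M ^ 2)⁻¹ ^ n * d p ∧ (M ^ 2)⁻¹ ^ n * d p < M) (fun n hn => ?_)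
    fun q _ n hn m hm => ?_
  · obtain ⟨q, hq⟩ := (Finset.mem_filter.1 hn).2
    exact ⟨q, Finset.mem_univ _, hq⟩
  · obtain ⟨-, h1, h2⟩ := hn
    obtain ⟨-, h3, h4⟩ := hm
    rcases lt_trichotomy n m with h' | h' | h'
    · exact absurd (key m q h3 n h') h2.not_ge
    · exact h'
    · exact absurd (key n q h1 m h') h4.not_ge

end Scales

/-! ### Assembly of the scales -/

section Main

variable {H : Type u} [NormedAddCommGroup H] [InnerProductSpace ℝ H] [MeasurableSpace H]
  [BorelSpace H]

theorem exists_coarseEmbedding_of_real (k : ℕ) (hk : 0 < k) :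
    ∃ (H' : Type u) (_ : NormedAddCommGroup H') (_ : InnerProductSpace ℝ H')
      (_ : CompleteSpace H') (φ : EmpiricalSpace k H → H'), IsCoarseEmbedding φ := by
  classical
  obtain ⟨F, _, _, _, f, hf⟩ := exists_gaussian_feature H
  have hk1 : (1 : ℝ) ≤ k := by exact_mod_cast hk
  set M : ℝ := 4 * k with hM
  have hM1 : 1 ≤ M := by linarith
  set a : ℝ := (M ^ 2)⁻¹ with ha
  have ha0 : 0 < a := by positivity
  have ha1 : a < 1 := inv_lt_one_of_one_lt₀ (by nlinarith)
  have hsum : Summable fun n : ℕ => (a ^ n) ^ 2 := by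
    simp_rw [← pow_mul, mul_comm _ 2, pow_mul]
    exact summable_geometric_of_lt_one (by positivity) (by nlinarith)
  choose x hx using fun α : EmpiricalSpace k H => α.2
  have hdist (α β : EmpiricalSpace k H) :
      dist α β = wassersteinOne (empiricalMeasure (x α)) (empiricalMeasure (x β)) := by
    rw [← hx α, ← hx β]; rfl
  let Φ : (Fin k → H) → ℕ → F := fun w n => (k : ℝ)⁻¹ • ∑ i, f (a ^ n • w i)
  have hLip (n : ℕ) (w w' : Fin k → H) : ‖Φ w n - Φ w' n‖ ≤
      a ^ n * wassersteinOne (empiricalMeasure w) (empiricalMeasure w') := by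
    refine norm_mean_sub_mean_le_wassersteinOne hk (f := fun v => f (a ^ n • v)) (by positivity)
      (fun u v => ?_) w w'
    refine (norm_sub_le_of_gaussian hf _ _).trans_eq ?_
    rw [← smul_sub, norm_smul, Real.norm_of_nonneg (by positivity), dist_eq_norm]
  have hsq (n : ℕ) (w w' : Fin k → H) : ‖Φ w n - Φ w' n‖ ^ 2 ≤
      (a ^ n) ^ 2 * wassersteinOne (empiricalMeasure w) (empiricalMeasure w') ^ 2 := by
    rw [← mul_pow]
    exact pow_le_pow_left₀ (norm_nonneg _) (hLip n w w') 2
  have hsummable (w w' : Fin k → H) : Summable fun n => ‖Φ w n - Φ w' n‖ ^ 2 :=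
    Summable.of_nonneg_of_le (fun n => by positivity) (fun n => hsq n w w') (hsum.mul_right _)
  -- `Φ w n` does not decay in `n`; subtracting a base configuration puts it in ℓ² and leaves
  -- differences unchanged.
  have hmem (w : Fin k → H) : Memℓp (fun n => Φ w n - Φ 0 n) 2 := by
    refine memℓp_gen ?_
    simpa using hsummable w 0
  let φ : EmpiricalSpace k H → lp (fun _ : ℕ => F) 2 := fun α => ⟨_, hmem (x α)⟩
  have hφ (α β : EmpiricalSpace k H) :
      dist (φ α) (φ β) ^ 2 = ∑' n, ‖Φ (x α) n - Φ (x β) n‖ ^ 2 := by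
    have h := lp.norm_rpow_eq_tsum (p := 2) (by norm_num) (φ α - φ β)
    have hc (n : ℕ) : (φ α - φ β) n = Φ (x α) n - Φ (x β) n := by
      rw [lp.coeFn_sub, Pi.sub_apply]
      exact sub_sub_sub_cancel_right _ _ _
    simp_rw [hc] at h
    rw [dist_eq_norm]
    simpa using h
  have hgood (w w' : Fin k → H) (n : ℕ)
      (hn : ¬ ∃ p : (Fin k ⊕ Fin k) × (Fin k ⊕ Fin k),
        M⁻¹ < a ^ n * dist (Sum.elim w w' p.1) (Sum.elim w w' p.2) ∧
        a ^ n * dist (Sum.elim w w' p.1) (Sum.elim w w' p.2) < M)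
      (hW : (M ^ 2) ^ n < wassersteinOne (empiricalMeasure w) (empiricalMeasure w')) :
      (2 * k ^ 2 : ℝ)⁻¹ ≤ ‖Φ w n - Φ w' n‖ ^ 2 := by
    have hds (u v : H) : dist (a ^ n • u) (a ^ n • v) = a ^ n * dist u v := by
      rw [dist_smul₀, Real.norm_of_nonneg (by positivity)]
    have hel (p : Fin k ⊕ Fin k) : Sum.elim (fun i => a ^ n • w i) (fun i => a ^ n • w' i) p =
        a ^ n • Sum.elim w w' p := by rcases p with p | p <;> rfl
    rcases matching_or_far hf hk (fun i => a ^ n • w i) (fun i => a ^ n • w' i) (fun p q => by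
      rw [hel, hel, hds]
      by_contra! h
      exact hn ⟨(p, q), h⟩) with ⟨σ, hσ⟩ | h
    -- Undoing the scaling, matched points lie within `(M ^ 2) ^ n * M⁻¹`, too close for `hW`.
    · refine absurd (wassersteinOne_le_matching hk w w' σ (r := (M ^ 2) ^ n) fun i => ?_) hW.not_ge
      have h1 := hσ i
      rw [hds, ha, inv_pow, inv_mul_le_iff₀ (by positivity)] at h1
      exact h1.trans (mul_le_of_le_one_right (by positivity) (inv_le_one_of_one_le₀ hM1))
    · simp only [Φ]
      rw [← smul_sub, norm_smul, mul_pow, Real.norm_of_nonneg (by positivity), mul_inv, inv_pow,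
        mul_comm]
      gcongr
      linarith
  let l : ℕ := (4 * k) ^ 2
  have hl : (l : ℝ) = M ^ 2 := by simp [l, hM]
  have hl1 : 1 < l := Nat.one_lt_pow (by norm_num) (by omega)
  refine ⟨lp (fun _ : ℕ => F) 2, inferInstance, inferInstance, inferInstance, φ,
    -- Scales before the logarithm, minus the bad ones, times the gain per good scale; `√` is 0 when
    -- this is negative.
    fun t => √((2 * k ^ 2 : ℝ)⁻¹ * ((Nat.log l ⌊t⌋₊ : ℝ) - 4 * k ^ 2)),
    fun t => √(∑' n : ℕ, (a ^ n) ^ 2) * t, ?_, ?_, fun t _ => Real.sqrt_nonneg _,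
    fun t ht => mul_nonneg (Real.sqrt_nonneg _) ht, ?_, fun α β => ⟨?_, ?_⟩⟩
  · intro s _ t _ hst
    dsimp only
    gcongr
  · intro s _ t _ hst
    dsimp only
    gcongr
  · refine Real.tendsto_sqrt_atTop.comp (Tendsto.const_mul_atTop (by positivity) ?_)
    refine tendsto_atTop_add_const_right _ _ (tendsto_natCast_atTop_atTop.comp ?_)
    refine Tendsto.comp (g := Nat.log l) ?_ tendsto_nat_floor_atTop
    refine tendsto_atTop.2 fun n => ?_
    filter_upwards [eventually_ge_atTop (l ^ n)] with m hm
    exact Nat.le_log_of_pow_le hl1 hm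
  · refine Real.sqrt_le_iff.2 ⟨dist_nonneg, ?_⟩
    rw [hφ, hdist]
    set w := x α
    set w' := x β
    set W := wassersteinOne (empiricalMeasure w) (empiricalMeasure w')
    set L := Nat.log l ⌊W⌋₊ with hL
    let P : ℕ → Prop := fun n => ∃ p : (Fin k ⊕ Fin k) × (Fin k ⊕ Fin k),
        M⁻¹ < a ^ n * dist (Sum.elim w w' p.1) (Sum.elim w w' p.2) ∧
        a ^ n * dist (Sum.elim w w' p.1) (Sum.elim w w' p.2) < M
    have hbad : ((Finset.range L).filter P).card ≤ 4 * k ^ 2 := by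
      refine (card_bad_scales_le hM1 (fun p : (Fin k ⊕ Fin k) × (Fin k ⊕ Fin k) =>
        dist (Sum.elim w w' p.1) (Sum.elim w w' p.2)) L).trans_eq ?_
      simp
      ring
    have hcount : (L : ℝ) - 4 * k ^ 2 ≤ ((Finset.range L).filter fun n => ¬ P n).card := by
      have h := Finset.card_filter_add_card_filter_not (s := Finset.range L) P
      rw [Finset.card_range] at h
      have h' : L ≤ 4 * k ^ 2 + ((Finset.range L).filter fun n => ¬ P n).card := by omega
      have : (L : ℝ) ≤ 4 * k ^ 2 + ((Finset.range L).filter fun n => ¬ P n).card := by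
        exact_mod_cast h'
      linarith
    have hWn (n : ℕ) (hn : n < L) : (M ^ 2) ^ n < W := by
      -- `Nat.log l 0 = 0`, so no `n < L` exists in that case.
      have h0 : ⌊W⌋₊ ≠ 0 := fun h => by simp [hL, h] at hn
      have h1 : l ^ n < ⌊W⌋₊ :=
        (Nat.pow_lt_pow_right hl1 hn).trans_le (Nat.pow_log_le_self l h0)
      rw [← hl]
      exact_mod_cast Nat.lt_of_lt_floor h1
    calc (2 * k ^ 2 : ℝ)⁻¹ * ((L : ℝ) - 4 * k ^ 2)
        ≤ (2 * k ^ 2 : ℝ)⁻¹ * ((Finset.range L).filter fun n => ¬ P n).card := by gcongr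
      _ = ∑ n ∈ (Finset.range L).filter fun n => ¬ P n, (2 * k ^ 2 : ℝ)⁻¹ := by
          rw [Finset.sum_const, nsmul_eq_mul, mul_comm]
      _ ≤ ∑ n ∈ (Finset.range L).filter fun n => ¬ P n, ‖Φ w n - Φ w' n‖ ^ 2 := by
          refine Finset.sum_le_sum fun n hn => ?_
          rw [Finset.mem_filter, Finset.mem_range] at hn
          exact hgood w w' n hn.2 (hWn n hn.1)
      _ ≤ ∑' n, ‖Φ w n - Φ w' n‖ ^ 2 :=
          (hsummable w w').sum_le_tsum _ fun n _ => by positivity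
  · have hW : 0 ≤ dist α β := ENNReal.toReal_nonneg
    refine le_of_sq_le_sq ?_ (mul_nonneg (Real.sqrt_nonneg _) hW)
    rw [hφ, mul_pow, Real.sq_sqrt (tsum_nonneg fun n => by positivity), ← tsum_mul_right, hdist]
    exact (hsummable _ _).tsum_le_tsum (fun n => hsq n _ _) (hsum.mul_right _)

end Main

theorem mainTheorem3 {𝕜 : Type*} [RCLike 𝕜] {H : Type u} [NormedAddCommGroup H]
    [InnerProductSpace 𝕜 H] [CompleteSpace H] [MeasurableSpace H] [BorelSpace H]
    (k : ℕ) (hk : 0 < k) :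
    ∃ (H' : Type u) (_ : NormedAddCommGroup H') (_ : InnerProductSpace ℝ H')
      (_ : CompleteSpace H') (φ : EmpiricalSpace k H → H'), IsCoarseEmbedding φ := by
  -- Restricting scalars keeps the norm, hence `W₁`.
  let _ : InnerProductSpace ℝ H := InnerProductSpace.rclikeToReal 𝕜 H
  exact exists_coarseEmbedding_of_real k hk
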